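/- Let $A\in\mathbb R^{n\times m}$ ($n,m\ge 1$) be the payoff matrix of a two-player zero-sum game: Player 1 chooses a row and maximizes $x^\top Ay$, Player 2 chooses a column and minimizes it, with mixed strategies $x\in S_n$, $y\in S_m$, where $S_k$ is the probability simplex in $\mathbb R^k$. Write $c_1,\dots,c_m$ for the columns of $A$, let $v=\max_{x\in S_n}\min_{y\in S_m}x^\top Ay$ be the value of the game, and let $\mathrm{NE}_1\subseteq S_n$ be the set of all $x$ that belong to some Nash equilibrium (saddle point) $(x,y)$. Assume: - (A1) $\mathrm{NE}_1$ has positive measure, that is, its image under $(x_1,\dots,x_n)\mapsto(x_1,\dots,x_{n-1})$ has positive Lebesgue measure in $\mathbb R^{n-1}$; - (A2) $\mathrm{NE}_1\cap\partial S_n=\emptyset$, where $\partial S_n$ is the boundary of $S_n$ relative to its affine hull; - $c_1=v\,\mathbf 1_n$. For $j\in\{1,\dots,m\}$ let $X_j=\{x\in S_n: c_j^\top x\le c_k^\top x \text{ for all } k\}$, and for $I\subseteq\{1,\dots,m\}$ let $B_I=\bigcap_{i\in I}X_i\cap\bigcap_{j\notin I}(S_n\setminus X_j)$, the set of $x\in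 S_n$ to which Player 2's set of pure best responses is exactly $I$. Let $1\in I$ and $|I|\ge 2$, and suppose that there is an index $l\in\{1,\dots,n\}$ such that every $w\in\mathrm{conv}\{c_i: i\in I\setminus\{1\}\}$ satisfies $w_l<\max_{1\le j\le n}w_j$. Consider any fictitious play in which Player 1 starts without a prior, that is, sequences $(\hat x(k))_{k\ge0}$ in $\mathbb R^n$ and $(\hat y(k))_{k\ge0}$ in $\mathbb R^m$ and a real $k_2\ge 0$ such that $\hat x(0)=0$; $\hat y(0)\in S_m$ if $k_2>0$ and $\hat y(0)=0$ if $k_2=0$; and for all $k\ge 0$ $$\hat x(k+1)=\frac{k\,\hat x(k)+e_{p_k}}{k+1},\qquad \hat y(k+1)=\frac{(k+k_2)\,\hat y(k)+e_{q_k}}{k+k_2+1},$$ with $p_k\in\arg\max_{i}\,(A\hat y(k))_i$ and $q_k\in\arg\min_{j}\,c_j^\top\hat x(k)$, ties being broken arbitrarily. Then $\hat x(k)$ does not converge to any point $x^*\in B_I$. -/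

import Mathlib

open Matrix

noncomputable section

namespace ZeroSum

/-- The coordinate map `(x₁, …, x_{n+1}) ↦ (x₁, …, x_n)`, which identifies the affine hull of the
simplex with `n + 1` vertices with `ℝⁿ`. -/
def coordMap (n : ℕ) (x : Fin (n + 1) → ℝ) : Fin n → ℝ := fun i => x i.castSucc

/-- The measure of a set of mixed strategies: the Lebesgue measure of its image in `ℝⁿ`. -/
def simplexMeasure {n : ℕ} (S : Set (Fin (n + 1) → ℝ)) : ENNReal :=
  MeasureTheory.volume (coordMap n '' S)

/-- The largest coordinate of a vector. -/
def maxCoord {n : ℕ} (w : Fin (n + 1) → ℝ) : ℝ :=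
  Finset.univ.sup' Finset.univ_nonempty w

variable {n m : ℕ}

/-- Player 1's expected payoff `xᵀ A y`; Player 2's is its negative. -/
def payoff (A : Matrix (Fin (n + 1)) (Fin (m + 1)) ℝ)
    (x : Fin (n + 1) → ℝ) (y : Fin (m + 1) → ℝ) : ℝ :=
  x ⬝ᵥ (A *ᵥ y)

/-- `(x, y)` is a mixed Nash equilibrium, i.e. a saddle point of the payoff. -/
structure IsNash (A : Matrix (Fin (n + 1)) (Fin (m + 1)) ℝ)
    (x : Fin (n + 1) → ℝ) (y : Fin (m + 1) → ℝ) : Prop where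
  mem_left : x ∈ stdSimplex ℝ (Fin (n + 1))
  mem_right : y ∈ stdSimplex ℝ (Fin (m + 1))
  left_optimal : ∀ x' ∈ stdSimplex ℝ (Fin (n + 1)), payoff A x' y ≤ payoff A x y
  right_optimal : ∀ y' ∈ stdSimplex ℝ (Fin (m + 1)), payoff A x y ≤ payoff A x y'

/-- The equilibrium strategies of Player 1. -/
def nashSet₁ (A : Matrix (Fin (n + 1)) (Fin (m + 1)) ℝ) : Set (Fin (n + 1) → ℝ) :=
  {x | ∃ y, IsNash A x y}

/-- The value `max_x min_y xᵀ A y` of the game. -/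
def gameValue (A : Matrix (Fin (n + 1)) (Fin (m + 1)) ℝ) : ℝ :=
  ⨆ x : stdSimplex ℝ (Fin (n + 1)), ⨅ y : stdSimplex ℝ (Fin (m + 1)),
    payoff A (x : Fin (n + 1) → ℝ) (y : Fin (m + 1) → ℝ)

/-- The column `c_j` of the payoff matrix. -/
def column (A : Matrix (Fin (n + 1)) (Fin (m + 1)) ℝ) (j : Fin (m + 1)) : Fin (n + 1) → ℝ :=
  fun i => A i j

/-- The pure best responses of Player 1 to `y`; all actions if `y = 0`. -/
def bestResponse₁ (A : Matrix (Fin (n + 1)) (Fin (m + 1)) ℝ) (y : Fin (m + 1) → ℝ) :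
    Set (Fin (n + 1)) :=
  {i | ∀ i', (A *ᵥ y) i' ≤ (A *ᵥ y) i}

/-- The pure best responses of Player 2 to `x`; all actions if `x = 0`. -/
def bestResponse₂ (A : Matrix (Fin (n + 1)) (Fin (m + 1)) ℝ) (x : Fin (n + 1) → ℝ) :
    Set (Fin (m + 1)) :=
  {j | ∀ j', column A j ⬝ᵥ x ≤ column A j' ⬝ᵥ x}

/-- The polyhedral region `X_j` of the strategies of Player 1 to which `j` is a best response. -/
def regionX (A : Matrix (Fin (n + 1)) (Fin (m + 1)) ℝ) (j : Fin (m + 1)) :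
    Set (Fin (n + 1) → ℝ) :=
  {x | x ∈ stdSimplex ℝ (Fin (n + 1)) ∧ ∀ j', column A j ⬝ᵥ x ≤ column A j' ⬝ᵥ x}

/-- The region `B_I` of the strategies of Player 1 to which the best-response set is exactly `I`. -/
def regionB (A : Matrix (Fin (n + 1)) (Fin (m + 1)) ℝ) (I : Finset (Fin (m + 1))) :
    Set (Fin (n + 1) → ℝ) :=
  {x | x ∈ stdSimplex ℝ (Fin (n + 1)) ∧ (∀ i ∈ I, x ∈ regionX A i) ∧ ∀ j ∉ I, x ∉ regionX A j}

/-- `(x k, y k)` is a trajectory of fictitious play with prior weights `k₁`, `k₂`. At each step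
the actions are arbitrary best responses, so every tie-breaking rule is covered. -/
structure IsFictitiousPlay (A : Matrix (Fin (n + 1)) (Fin (m + 1)) ℝ) (k₁ k₂ : ℝ)
    (x : ℕ → Fin (n + 1) → ℝ) (y : ℕ → Fin (m + 1) → ℝ) : Prop where
  nonneg₁ : 0 ≤ k₁
  nonneg₂ : 0 ≤ k₂
  init_zero₁ : k₁ = 0 → x 0 = 0
  init_zero₂ : k₂ = 0 → y 0 = 0
  init_pos₁ : 0 < k₁ → x 0 ∈ stdSimplex ℝ (Fin (n + 1))
  init_pos₂ : 0 < k₂ → y 0 ∈ stdSimplex ℝ (Fin (m + 1))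
  step₁ : ∀ k : ℕ, ∃ p ∈ bestResponse₁ A (y k),
    x (k + 1) = ((k : ℝ) + k₁ + 1)⁻¹ • (((k : ℝ) + k₁) • x k + Pi.single p (1 : ℝ))
  step₂ : ∀ k : ℕ, ∃ q ∈ bestResponse₂ A (x k),
    y (k + 1) = ((k : ℝ) + k₂ + 1)⁻¹ • (((k : ℝ) + k₂) • y k + Pi.single q (1 : ℝ))

/-- Player 1's equilibrium set has positive measure. -/
def PositiveMeasure (A : Matrix (Fin (n + 1)) (Fin (m + 1)) ℝ) : Prop :=
  0 < simplexMeasure (nashSet₁ A)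

/-- Every equilibrium strategy of Player 1 is fully mixed: the equilibrium set misses the
boundary of the simplex (relative to its affine hull). -/
def FullyMixed (A : Matrix (Fin (n + 1)) (Fin (m + 1)) ℝ) : Prop :=
  intrinsicFrontier ℝ (stdSimplex ℝ (Fin (n + 1))) ∩ nashSet₁ A = ∅

end ZeroSum

end

open Matrix Filter Topology

namespace ZeroSum

variable {n m : ℕ} {A : Matrix (Fin (n + 1)) (Fin (m + 1)) ℝ}

/-! ### Saddle points and the value. -/

section Game

/-! Since column `0` pays the value `v` identically, a limit in `B_I` is an equilibrium strategy,
hence fully mixed; every action of Player 1 must then be played infinitely often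
(`eq_zero_of_eventually_ne`). It suffices to find an action that is eventually abandoned.

If non-constant columns recur, the cumulative payoffs drift along the convex hull of the columns of
`I` other than `0`. There `l` trails the maximum by a uniform gap, so `l` eventually stops being a
best response (`eventually_ne_of_frequently`).

Otherwise there is a last non-constant reply. From then on payoff differences are frozen, so an
action that is behind stays behind. Some action is behind: full indifference just after that reply
would force its column to be constant (`not_indifferent`). Such a reply exists because the first
action is a vertex, which is not an equilibrium strategy (`column_one_ne_const`). -/

lemma payoff_eq_sum (x : Fin (n + 1) → ℝ) (y : Fin (m + 1) → ℝ) :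
    payoff A x y = ∑ j, (column A j ⬝ᵥ x) * y j := by
  rw [payoff, dotProduct_mulVec]
  refine Finset.sum_congr rfl fun j _ => ?_
  rw [dotProduct_comm]
  rfl

lemma le_payoff {x : Fin (n + 1) → ℝ} {y : Fin (m + 1) → ℝ}
    (hy : y ∈ stdSimplex ℝ (Fin (m + 1))) {v : ℝ} (hv : ∀ j, v ≤ column A j ⬝ᵥ x) :
    v ≤ payoff A x y := by
  rw [payoff_eq_sum]
  calc v = ∑ j, v * y j := by rw [← Finset.mul_sum, hy.2, mul_one]
    _ ≤ _ := Finset.sum_le_sum fun j _ => mul_le_mul_of_nonneg_right (hv j) (hy.1 j)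

lemma bddBelow_payoff (x : Fin (n + 1) → ℝ) :
    BddBelow (Set.range fun y : stdSimplex ℝ (Fin (m + 1)) =>
      payoff A x (y : Fin (m + 1) → ℝ)) := by
  refine ⟨Finset.univ.inf' Finset.univ_nonempty fun j => column A j ⬝ᵥ x, ?_⟩
  rintro _ ⟨y, rfl⟩
  exact le_payoff y.2 fun j => Finset.inf'_le _ (Finset.mem_univ j)

/-- The saddle inequality bounds every inner infimum by the equilibrium payoff, which also supplies
the boundedness that the real supremum needs; `x` attains the bound. -/
lemma IsNash.gameValue_eq {x : Fin (n + 1) → ℝ} {y : Fin (m + 1) → ℝ} (h : IsNash A x y) :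
    gameValue A = payoff A x y := by
  have : Nonempty (stdSimplex ℝ (Fin (n + 1))) := ⟨⟨x, h.mem_left⟩⟩
  have : Nonempty (stdSimplex ℝ (Fin (m + 1))) := ⟨⟨y, h.mem_right⟩⟩
  have hle : ∀ x' : stdSimplex ℝ (Fin (n + 1)),
      ⨅ y' : stdSimplex ℝ (Fin (m + 1)), payoff A (x' : Fin (n + 1) → ℝ) (y' : Fin (m + 1) → ℝ)
        ≤ payoff A x y := fun x' =>
    (ciInf_le (bddBelow_payoff _) ⟨y, h.mem_right⟩).trans (h.left_optimal x' x'.2)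
  refine le_antisymm (ciSup_le hle) ?_
  refine le_ciSup_of_le ⟨payoff A x y, ?_⟩ ⟨x, h.mem_left⟩ ?_
  · rintro _ ⟨x', rfl⟩
    exact hle x'
  · exact le_ciInf fun z => h.right_optimal z z.2

/-- A strategy that guarantees the value against every column is an equilibrium strategy, provided
that an equilibrium exists. -/
lemma mem_nashSet₁_of_le (hne : (nashSet₁ A).Nonempty) {x : Fin (n + 1) → ℝ}
    (hx : x ∈ stdSimplex ℝ (Fin (n + 1))) (hv : ∀ j, gameValue A ≤ column A j ⬝ᵥ x) :
    x ∈ nashSet₁ A := by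
  -- Saddle points are interchangeable: the partner of `x` is the `y'` of any given equilibrium.
  obtain ⟨x', y', h⟩ := hne
  have hval := h.gameValue_eq
  refine ⟨y', hx, h.mem_right, fun x'' hx'' => ?_, fun y'' hy'' => ?_⟩
  · exact (h.left_optimal x'' hx'').trans (hval ▸ le_payoff h.mem_right hv)
  · exact (h.left_optimal x hx).trans (hval ▸ le_payoff hy'' hv)

lemma PositiveMeasure.nonempty (h : PositiveMeasure A) : (nashSet₁ A).Nonempty := by
  rw [Set.nonempty_iff_ne_empty]
  intro he
  simp [PositiveMeasure, simplexMeasure, he] at h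

end Game

/-! ### The relative boundary of the simplex. -/

section Simplex

/-- A point of the simplex with a vanishing coordinate lies in its relative boundary. -/
lemma mem_intrinsicFrontier_stdSimplex {ι : Type*} [Fintype ι] [DecidableEq ι] {x : ι → ℝ}
    (hx : x ∈ stdSimplex ℝ ι) {l : ι} (hl : x l = 0) :
    x ∈ intrinsicFrontier ℝ (stdSimplex ℝ ι) := by
  rw [← intrinsicClosure_sdiff_intrinsicInterior]
  refine ⟨subset_intrinsicClosure hx, fun hint => ?_⟩
  obtain ⟨z, hz, hzx⟩ := mem_intrinsicInterior.1 hint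
  have hxs : x ∈ affineSpan ℝ (stdSimplex ℝ ι) := subset_affineSpan ℝ _ hx
  have hes : (Pi.single l 1 : ι → ℝ) ∈ affineSpan ℝ (stdSimplex ℝ ι) :=
    subset_affineSpan ℝ _ (single_mem_stdSimplex ℝ l)
  -- The line from `x` through the vertex `l` stays in the affine span, but its coordinate `l`
  -- equals `t`, so it leaves the simplex for `t < 0`.
  have hmem : ∀ t : ℝ, AffineMap.lineMap x (Pi.single l 1 : ι → ℝ) t ∈
      affineSpan ℝ (stdSimplex ℝ ι) := fun t => AffineMap.lineMap_mem t hxs hes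
  let f : ℝ → affineSpan ℝ (stdSimplex ℝ ι) := fun t => ⟨_, hmem t⟩
  have hf : Continuous f := by
    refine Continuous.subtype_mk ?_ _
    exact AffineMap.lineMap_continuous
  have hf0 : f 0 = z := Subtype.ext (by simp [f, hzx])
  have hev : ∀ᶠ t in 𝓝 (0 : ℝ), f t ∈ interior ((↑) ⁻¹' stdSimplex ℝ ι :
      Set (affineSpan ℝ (stdSimplex ℝ ι))) :=
    hf.continuousAt.eventually (hf0 ▸ isOpen_interior.mem_nhds hz)
  obtain ⟨t, ht, htneg⟩ := ((hev.filter_mono nhdsWithin_le_nhds).and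
    (self_mem_nhdsWithin : Set.Iio (0 : ℝ) ∈ 𝓝[<] 0)).exists
  have hft := interior_subset ht
  rw [Set.mem_preimage] at hft
  have := hft.1 l
  simp [f, AffineMap.lineMap_apply, hl] at this
  exact absurd htneg (not_lt.2 this)

lemma FullyMixed.pos (h : FullyMixed A) {x : Fin (n + 1) → ℝ} (hx : x ∈ nashSet₁ A)
    (l : Fin (n + 1)) : 0 < x l := by
  obtain ⟨y, hy⟩ := hx
  refine lt_of_le_of_ne (hy.mem_left.1 l) fun h0 => ?_
  exact (Set.eq_empty_iff_forall_notMem.1 h x)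
    ⟨mem_intrinsicFrontier_stdSimplex hy.mem_left h0.symm, y, hy⟩

lemma dotProduct_const_of_mem_stdSimplex {x : Fin (n + 1) → ℝ}
    (hx : x ∈ stdSimplex ℝ (Fin (n + 1))) (v : ℝ) : (fun _ => v) ⬝ᵥ x = v := by
  simp only [dotProduct]
  rw [← Finset.mul_sum, hx.2, mul_one]

end Simplex

/-! ### Gap below the largest coordinate. -/

section MaxCoord

lemma exists_eq_maxCoord (w : Fin (n + 1) → ℝ) : ∃ i, maxCoord w = w i := by
  obtain ⟨i, -, h⟩ := Finset.exists_mem_eq_sup' Finset.univ_nonempty w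
  exact ⟨i, h⟩

lemma continuous_maxCoord : Continuous (maxCoord (n := n)) := by
  unfold maxCoord
  exact Continuous.finset_sup'_apply _ fun i _ => continuous_apply i

/-- On a compact set the gap between the largest coordinate and a coordinate that is nowhere
maximal is bounded away from zero. -/
lemma exists_gap_of_isCompact {K : Set (Fin (n + 1) → ℝ)} (hK : IsCompact K) {l : Fin (n + 1)}
    (hl : ∀ w ∈ K, w l < maxCoord w) : ∃ δ > 0, ∀ w ∈ K, ∃ i, w l + δ ≤ w i := by
  rcases K.eq_empty_or_nonempty with rfl | hne
  · exact ⟨1, one_pos, by simp⟩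
  obtain ⟨w₀, hw₀, hmin⟩ := hK.exists_isMinOn hne
    (f := fun w => maxCoord w - w l)
    (continuous_maxCoord.sub (continuous_apply l)).continuousOn
  refine ⟨maxCoord w₀ - w₀ l, sub_pos.2 (hl w₀ hw₀), fun w hw => ?_⟩
  obtain ⟨i, hi⟩ := exists_eq_maxCoord w
  have h : maxCoord w₀ - w₀ l ≤ maxCoord w - w l := hmin hw
  exact ⟨i, by linarith⟩

end MaxCoord

/-! ### Dynamics of cumulative payoffs. -/

section Play

/-- Fictitious play without a prior for Player 1, in terms of the actions `p k`, `q k` and the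
cumulative payoff vectors `u k` of Player 1's actions. -/
structure IsCumulativePlay (A : Matrix (Fin (n + 1)) (Fin (m + 1)) ℝ)
    (x : ℕ → Fin (n + 1) → ℝ) (u : ℕ → Fin (n + 1) → ℝ)
    (p : ℕ → Fin (n + 1)) (q : ℕ → Fin (m + 1)) : Prop where
  step_left : ∀ k : ℕ, ((k + 1 : ℕ) : ℝ) • x (k + 1) = (k : ℝ) • x k + Pi.single (p k) 1
  step_right : ∀ k : ℕ, u (k + 1) = u k + column A (q k)
  best_left : ∀ k : ℕ, 1 ≤ k → ∀ i, u k i ≤ u k (p k)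
  best_right : ∀ k : ℕ, ∀ j, column A (q k) ⬝ᵥ x k ≤ column A j ⬝ᵥ x k

lemma IsFictitiousPlay.exists_isCumulativePlay {k₂ : ℝ} {x : ℕ → Fin (n + 1) → ℝ}
    {y : ℕ → Fin (m + 1) → ℝ} (h : IsFictitiousPlay A 0 k₂ x y) :
    ∃ u p q, IsCumulativePlay A x u p q := by
  choose p hp hxs using h.step₁
  choose q hq hys using h.step₂
  have hk₂ := h.nonneg₂
  -- Rescaling by the total weight makes the update additive and, being nonnegative, keeps best
  -- responses best.
  refine ⟨fun k => ((k : ℝ) + k₂) • (A *ᵥ y k), p, q, fun k => ?_, fun k => ?_, fun k hk i => ?_,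
    fun k j => hq k j⟩
  · have : (k : ℝ) + 1 ≠ 0 := by positivity
    rw [hxs k]
    push_cast
    rw [add_zero, smul_smul, mul_inv_cancel₀ this, one_smul]
  · have : (k : ℝ) + k₂ + 1 ≠ 0 := by positivity
    have hc : ((k + 1 : ℕ) : ℝ) + k₂ = k + k₂ + 1 := by push_cast; ring
    simp only [hc]
    rw [hys k, mulVec_smul, smul_smul, mul_inv_cancel₀ this, one_smul, mulVec_add, mulVec_smul,
      mulVec_single_one]
    rfl
  · exact mul_le_mul_of_nonneg_left (hp k i) (by positivity)

namespace IsCumulativePlay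

variable {x u : ℕ → Fin (n + 1) → ℝ} {p : ℕ → Fin (n + 1)} {q : ℕ → Fin (m + 1)}

lemma mem_stdSimplex (h : IsCumulativePlay A x u p q) {k : ℕ} (hk : 1 ≤ k) :
    x k ∈ stdSimplex ℝ (Fin (n + 1)) := by
  -- The induction runs on `k • x k`, because `x 0` need not lie in the simplex.
  have key : ∀ k : ℕ, (∀ i, 0 ≤ ((k : ℝ) • x k) i) ∧ ∑ i, ((k : ℝ) • x k) i = k := by
    intro k
    induction k with
    | zero => simp
    | succ k ih =>
      rw [h.step_left k]
      refine ⟨fun i => ?_, ?_⟩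
      · exact add_nonneg (ih.1 i) ((single_mem_stdSimplex ℝ (p k)).1 i)
      · simp only [Pi.add_apply, Finset.sum_add_distrib]
        rw [ih.2, (single_mem_stdSimplex ℝ (p k)).2]
        push_cast
        rfl
  have hk0 : (0 : ℝ) < k := by exact_mod_cast hk
  obtain ⟨h1, h2⟩ := key k
  refine ⟨fun i => ?_, ?_⟩
  · have := h1 i
    rw [Pi.smul_apply, smul_eq_mul] at this
    exact nonneg_of_mul_nonneg_right this hk0
  · simp only [Pi.smul_apply, smul_eq_mul, ← Finset.mul_sum] at h2
    exact mul_left_cancel₀ hk0.ne' (by rw [h2, mul_one])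

/-- The weight of an action that is no longer played tends to zero. -/
lemma eq_zero_of_eventually_ne (h : IsCumulativePlay A x u p q) {z : Fin (n + 1) → ℝ}
    (hlim : Tendsto x atTop (𝓝 z)) {l : Fin (n + 1)} (hl : ∀ᶠ k in atTop, p k ≠ l) :
    z l = 0 := by
  obtain ⟨K, hK⟩ := eventually_atTop.1 hl
  have hconst : ∀ k ≥ K, (k : ℝ) * x k l = K * x K l := by
    intro k hk
    induction k, hk using Nat.le_induction with
    | base => rfl
    | succ k hk ih =>
      have := congrFun (h.step_left k) l
      simp only [Pi.smul_apply, smul_eq_mul, Pi.add_apply, Pi.single_eq_of_ne' (hK k hk)] at this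
      rw [this, ih, add_zero]
  refine tendsto_nhds_unique ((tendsto_pi_nhds.1 hlim) l) ?_
  refine (tendsto_const_div_atTop_nhds_zero_nat ((K : ℝ) * x K l)).congr' ?_
  filter_upwards [eventually_ge_atTop K, eventually_ge_atTop 1] with k hk hk1
  have : (k : ℝ) ≠ 0 := by positivity
  rw [← hconst k hk]
  field_simp

/-- As long as Player 2 plays columns equal to a constant vector or from a set with convex hull
`C`, the cumulative payoff vector is, up to multiples of the all-ones vector, shifted by
`M • w` with `w ∈ C`, where `M` exceeds any bound if the other columns recur. -/
lemma exists_large_shift (h : IsCumulativePlay A x u p q) {v : ℝ} {C : Set (Fin (n + 1) → ℝ)}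
    (hC : Convex ℝ C) (hne : C.Nonempty) {K : ℕ}
    (hq : ∀ k ≥ K, column A (q k) = (fun _ => v) ∨ column A (q k) ∈ C)
    (hfreq : ∃ᶠ k in atTop, column A (q k) ≠ fun _ => v) (N : ℕ) :
    ∃ T ≥ K, ∀ k ≥ T, ∃ M : ℝ, ∃ a : ℝ, ∃ w ∈ C, (N : ℝ) ≤ M ∧
      ∀ i, u k i = u K i + a + M * w i := by
  have hstep : ∀ (N : ℝ) (k : ℕ), 0 ≤ N → K ≤ k →
      (∃ M : ℝ, ∃ a : ℝ, ∃ w ∈ C, N ≤ M ∧ ∀ i, u k i = u K i + a + M * w i) →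
      (∃ M : ℝ, ∃ a : ℝ, ∃ w ∈ C,
        (N + if column A (q k) = (fun _ => v) then 0 else 1) ≤ M ∧
        ∀ i, u (k + 1) i = u K i + a + M * w i) := by
    rintro N k hN hk ⟨M, a, w, hw, hM, hu⟩
    by_cases hc : column A (q k) = fun _ => v
    · refine ⟨M, a + v, w, hw, by simpa [hc] using hM, fun i => ?_⟩
      rw [h.step_right, Pi.add_apply, hu, hc]
      ring
    · have hmem := (hq k hk).resolve_left hc
      have hM1 : 0 < M + 1 := by linarith
      refine ⟨M + 1, a, (M / (M + 1)) • w + (1 / (M + 1)) • column A (q k),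
        hC hw hmem (div_nonneg (by linarith) hM1.le) (by positivity) (by field_simp),
        by simpa [hc] using hM, fun i => ?_⟩
      rw [h.step_right, Pi.add_apply, hu]
      simp only [Pi.add_apply, Pi.smul_apply, smul_eq_mul]
      field_simp
      ring
  have hextend : ∀ (N : ℝ) (T : ℕ), 0 ≤ N → K ≤ T →
      (∃ M : ℝ, ∃ a : ℝ, ∃ w ∈ C, N ≤ M ∧ ∀ i, u T i = u K i + a + M * w i) →
      ∀ k ≥ T, ∃ M : ℝ, ∃ a : ℝ, ∃ w ∈ C, N ≤ M ∧ ∀ i, u k i = u K i + a + M * w i := by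
    intro N T hN hT hT' k hk
    induction k, hk using Nat.le_induction with
    | base => exact hT'
    | succ k hk ih =>
      obtain ⟨M, a, w, hw, hM, hu⟩ := hstep N k hN (hT.trans hk) ih
      refine ⟨M, a, w, hw, le_trans ?_ hM, hu⟩
      split_ifs <;> linarith
  induction N with
  | zero =>
    obtain ⟨w, hw⟩ := hne
    exact ⟨K, le_rfl, hextend _ K (by simp) le_rfl ⟨0, 0, w, hw, by simp, by simp⟩⟩
  | succ N ih =>
    obtain ⟨T, hT, hall⟩ := ih
    obtain ⟨t, ht, hne'⟩ := frequently_atTop.1 hfreq T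
    have h1 := hstep N t (by positivity) (hT.trans ht) (hall t ht)
    rw [if_neg hne'] at h1
    refine ⟨t + 1, by omega, ?_⟩
    push_cast
    exact hextend _ (t + 1) (by positivity) (by omega) h1

/-- If columns from a compact convex set on which the coordinate `l` is never maximal recur, and
all others are constant, then eventually `l` is not a best response. -/
lemma eventually_ne_of_frequently (h : IsCumulativePlay A x u p q) {v : ℝ}
    {C : Set (Fin (n + 1) → ℝ)} (hC : Convex ℝ C) (hCc : IsCompact C) (hne : C.Nonempty)
    {l : Fin (n + 1)} (hl : ∀ w ∈ C, w l < maxCoord w)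
    (hq : ∀ᶠ k in atTop, column A (q k) = (fun _ => v) ∨ column A (q k) ∈ C)
    (hfreq : ∃ᶠ k in atTop, column A (q k) ≠ fun _ => v) :
    ∀ᶠ k in atTop, p k ≠ l := by
  obtain ⟨K, hK⟩ := eventually_atTop.1 hq
  obtain ⟨δ, hδ, hgap⟩ := exists_gap_of_isCompact hCc hl
  -- With this `N`, the drift `M * δ` outweighs every payoff lead of `l` at time `K`.
  obtain ⟨N, hN⟩ := exists_nat_gt ((∑ i, |u K i - u K l|) / δ)
  obtain ⟨T, -, hT⟩ := h.exists_large_shift hC hne hK hfreq N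
  filter_upwards [eventually_ge_atTop T, eventually_ge_atTop 1] with k hk hk1 hp
  obtain ⟨M, a, w, hw, hM, hu⟩ := hT k hk
  obtain ⟨i, hi⟩ := hgap w hw
  have hbest := h.best_left k hk1 i
  rw [hp, hu, hu] at hbest
  have hsum : |u K i - u K l| ≤ ∑ i, |u K i - u K l| :=
    Finset.single_le_sum (f := fun i => |u K i - u K l|) (fun _ _ => abs_nonneg _)
      (Finset.mem_univ i)
  have hlt : (∑ i, |u K i - u K l|) < M * δ :=
    ((div_lt_iff₀ hδ).1 hN).trans_le (mul_le_mul_of_nonneg_right hM hδ.le)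
  have hM0 : 0 ≤ M := (Nat.cast_nonneg N).trans hM
  have hMw : M * (w l + δ) ≤ M * w i := mul_le_mul_of_nonneg_left hi hM0
  have := neg_abs_le (u K i - u K l)
  nlinarith

/-- If Player 2 eventually plays only constant columns, then Player 1's cumulative payoffs at the
start of that phase decide all later best responses. -/
lemma exists_eq_add_const (h : IsCumulativePlay A x u p q) {v : ℝ} {K : ℕ}
    (hq : ∀ k ≥ K, column A (q k) = fun _ => v) :
    ∀ k ≥ K, ∃ a : ℝ, ∀ i, u k i = u K i + a := by
  intro k hk
  induction k, hk using Nat.le_induction with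
  | base => exact ⟨0, by simp⟩
  | succ k hk ih =>
    obtain ⟨a, ha⟩ := ih
    refine ⟨a + v, fun i => ?_⟩
    rw [h.step_right, Pi.add_apply, ha, hq k hk]
    ring

/-- After a non-constant column is played at `t ≥ 1`, either the next column is non-constant too,
or Player 1 is not indifferent between all actions at time `t + 1`. -/
lemma not_indifferent (h : IsCumulativePlay A x u p q) (hne : (nashSet₁ A).Nonempty)
    (hA2 : FullyMixed A) (hcol : column A 0 = fun _ => gameValue A) {t : ℕ} (ht : 1 ≤ t)
    (hqt : column A (q t) ≠ fun _ => gameValue A)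
    (hqt' : column A (q (t + 1)) = fun _ => gameValue A) :
    ∃ i i', u (t + 1) i < u (t + 1) i' := by
  by_contra! hcon
  set v := gameValue A
  set c := column A (q t)
  have hxt := h.mem_stdSimplex ht
  have hxt' := h.mem_stdSimplex (Nat.le_add_left 1 t)
  -- `p t` led before column `c` was added and all are level afterwards, so `p t` gained least.
  have hmin : ∀ i, c (p t) ≤ c i := by
    intro i
    have h1 := hcon i (p t)
    have h2 := h.best_left t ht i
    rw [h.step_right, Pi.add_apply, Pi.add_apply] at h1
    linarith
  have hcx : c ⬝ᵥ x t ≤ v := by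
    have := h.best_right t 0
    rwa [hcol, dotProduct_const_of_mem_stdSimplex hxt] at this
  have hcx' : v ≤ c ⬝ᵥ x (t + 1) := by
    have := h.best_right (t + 1) (q t)
    rwa [hqt', dotProduct_const_of_mem_stdSimplex hxt'] at this
  have hstep : ((t : ℝ) + 1) * (c ⬝ᵥ x (t + 1)) = t * (c ⬝ᵥ x t) + c (p t) := by
    have := congrArg (fun z => c ⬝ᵥ z) (h.step_left t)
    simpa [dotProduct_smul, dotProduct_add] using this
  -- Adding one play of `p t` raises the average of `c` from at most `v` to at least `v`.
  have hcp : v ≤ c (p t) := by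
    have h1 := mul_le_mul_of_nonneg_left hcx (Nat.cast_nonneg (α := ℝ) t)
    have h2 := mul_le_mul_of_nonneg_left hcx' (by positivity : (0 : ℝ) ≤ (t : ℝ) + 1)
    linarith
  -- Now `c ≥ v` everywhere while its average under `x t` is at most `v`. So `x t` is an equilibrium
  -- strategy, and its full support forces `c = v`.
  have hsum : ∑ i, (c i - v) * x t i = c ⬝ᵥ x t - v := by
    simp only [sub_mul, Finset.sum_sub_distrib, ← Finset.mul_sum, hxt.2, mul_one]
    rfl
  have hnn : ∀ i ∈ Finset.univ, 0 ≤ (c i - v) * x t i := fun i _ =>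
    mul_nonneg (by linarith [hmin i]) (hxt.1 i)
  have hzero : ∑ i, (c i - v) * x t i = 0 :=
    le_antisymm (by linarith) (Finset.sum_nonneg hnn)
  have hnash : x t ∈ nashSet₁ A :=
    mem_nashSet₁_of_le hne hxt fun j => by linarith [h.best_right t j]
  refine hqt (funext fun i => ?_)
  have := (mul_eq_zero.1 ((Finset.sum_eq_zero_iff_of_nonneg hnn).1 hzero i
    (Finset.mem_univ i))).resolve_right (hA2.pos hnash i).ne'
  linarith

/-- Player 2's reply to the first action of Player 1, a vertex of the simplex, is non-constant. -/
lemma column_one_ne_const (h : IsCumulativePlay A x u p q) (hne : (nashSet₁ A).Nonempty)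
    (hA2 : FullyMixed A) (hn : n ≠ 0) : column A (q 1) ≠ fun _ => gameValue A := by
  intro hq
  have hx1 := h.mem_stdSimplex le_rfl
  have hnash : x 1 ∈ nashSet₁ A := mem_nashSet₁_of_le hne hx1 fun j => by
    have := h.best_right 1 j
    rwa [hq, dotProduct_const_of_mem_stdSimplex hx1] at this
  have hx : x 1 = Pi.single (p 0) 1 := by simpa using h.step_left 0
  have : Nontrivial (Fin (n + 1)) := Fin.nontrivial_iff_two_le.2 (by omega)
  obtain ⟨i, hi⟩ := exists_ne (p 0)
  have := hA2.pos hnash i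
  rw [hx, Pi.single_eq_of_ne hi] at this
  exact lt_irrefl _ this

/-- If Player 2 eventually plays only constant columns, then some action of Player 1 is played
only finitely often. -/
lemma exists_eventually_ne (h : IsCumulativePlay A x u p q) (hne : (nashSet₁ A).Nonempty)
    (hA2 : FullyMixed A) (hcol : column A 0 = fun _ => gameValue A) (hn : n ≠ 0)
    (hq : ∀ᶠ k in atTop, column A (q k) = fun _ => gameValue A) :
    ∃ l, ∀ᶠ k in atTop, p k ≠ l := by
  classical
  obtain ⟨K, hK⟩ := eventually_atTop.1 hq
  let P : ℕ → Prop := fun t => column A (q t) ≠ fun _ => gameValue A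
  have hP1 : P 1 := h.column_one_ne_const hne hA2 hn
  have hbound : ∀ t, P t → t ≤ K := fun t ht => le_of_not_ge fun hKt => ht (hK t hKt)
  let t := Nat.findGreatest P K
  -- `t` is the last non-constant reply.
  have ht1 : 1 ≤ t := Nat.le_findGreatest (hbound 1 hP1) hP1
  have htP : P t := Nat.findGreatest_spec (hbound 1 hP1) hP1
  have hafter : ∀ k ≥ t + 1, column A (q k) = fun _ => gameValue A := by
    intro k hk
    by_contra hPk
    have : k ≤ t := Nat.le_findGreatest (hbound k hPk) hPk
    omega
  obtain ⟨l, i, hli⟩ := h.not_indifferent hne hA2 hcol ht1 htP (hafter _ le_rfl)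
  refine ⟨l, ?_⟩
  filter_upwards [eventually_ge_atTop (t + 1)] with k hk hp
  obtain ⟨a, ha⟩ := h.exists_eq_add_const hafter k hk
  have := h.best_left k (by omega) i
  rw [hp, ha, ha] at this
  linarith

/-- Best responses of Player 2 near a point of `B_I` belong to `I`. -/
lemma eventually_mem_of_tendsto (h : IsCumulativePlay A x u p q) {I : Finset (Fin (m + 1))}
    {z : Fin (n + 1) → ℝ} (hz : z ∈ regionB A I) (hlim : Tendsto x atTop (𝓝 z)) :
    ∀ᶠ k in atTop, q k ∈ I := by
  have hev : ∀ j ∉ I, ∀ᶠ k in atTop, q k ≠ j := by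
    intro j hj
    have hj' := hz.2.2 j hj
    simp only [regionX, Set.mem_ofPred_eq, not_and, not_forall, not_le] at hj'
    obtain ⟨j', hj'⟩ := hj' hz.1
    have hc : ∀ c : Fin (n + 1) → ℝ, Tendsto (fun k => c ⬝ᵥ x k) atTop (𝓝 (c ⬝ᵥ z)) := fun c =>
      ((continuous_const.dotProduct continuous_id).tendsto z).comp hlim
    filter_upwards [(hc _).eventually_lt (hc _) hj'] with k hk hqk
    exact absurd (h.best_right k j') (not_le.2 (hqk ▸ hk))
  have hall : ∀ᶠ k in atTop, ∀ j, j ∉ I → q k ≠ j :=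
    eventually_all.2 fun j => by
      by_cases hj : j ∈ I
      · exact Eventually.of_forall fun _ hj' => absurd hj hj'
      · filter_upwards [hev j hj] with k hk _ using hk
  filter_upwards [hall] with k hk
  by_contra hcon
  exact hk _ hcon rfl

end IsCumulativePlay

lemma regionB_subset_nashSet₁ (hne : (nashSet₁ A).Nonempty)
    (hcol : column A 0 = fun _ => gameValue A) {I : Finset (Fin (m + 1))} (h0 : 0 ∈ I) :
    regionB A I ⊆ nashSet₁ A := fun z hz => mem_nashSet₁_of_le hne hz.1 fun j => by
  have := (hz.2.1 0 h0).2 j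
  rwa [hcol, dotProduct_const_of_mem_stdSimplex hz.1] at this

end Play

end ZeroSum

theorem mainTheorem2 {n m : ℕ} (A : Matrix (Fin (n + 1)) (Fin (m + 1)) ℝ)
    (hA1 : ZeroSum.PositiveMeasure A) (hA2 : ZeroSum.FullyMixed A)
    (hcol : ZeroSum.column A 0 = fun _ => ZeroSum.gameValue A)
    (I : Finset (Fin (m + 1))) (h0I : 0 ∈ I) (hI : 2 ≤ I.card)
    (hl : ∃ l : Fin (n + 1), ∀ w ∈ convexHull ℝ (ZeroSum.column A '' {i | i ∈ I ∧ i ≠ 0}),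
      w l < ZeroSum.maxCoord w)
    (k₂ : ℝ) (x : ℕ → Fin (n + 1) → ℝ) (y : ℕ → Fin (m + 1) → ℝ)
    (hFP : ZeroSum.IsFictitiousPlay A 0 k₂ x y)
    (xstar : Fin (n + 1) → ℝ) (hx : xstar ∈ ZeroSum.regionB A I) :
    ¬ Filter.Tendsto x Filter.atTop (nhds xstar) := by
  intro hlim
  obtain ⟨u, p, q, h⟩ := hFP.exists_isCumulativePlay
  have hne := hA1.nonempty
  have hpos := hA2.pos (ZeroSum.regionB_subset_nashSet₁ hne hcol h0I hx)
  obtain ⟨l, hl⟩ := hl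
  set S := ZeroSum.column A '' {i | i ∈ I ∧ i ≠ 0}
  have hSne : S.Nonempty := by
    obtain ⟨i, hi, hi0⟩ := Finset.exists_mem_ne hI 0
    exact ⟨_, i, ⟨hi, hi0⟩, rfl⟩
  have hSfin : S.Finite := (Set.toFinite _).image _
  -- With a single action, its coordinate is always the largest, against the choice of `l`.
  have hn : n ≠ 0 := by
    rintro rfl
    obtain ⟨w, hw⟩ := hSne
    obtain ⟨i, hi⟩ := ZeroSum.exists_eq_maxCoord w
    have := hl w (subset_convexHull ℝ S hw)
    rw [hi, Fin.ext (a := i) (b := l) (by omega)] at this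
    exact lt_irrefl _ this
  suffices ∃ l, ∀ᶠ k in atTop, p k ≠ l by
    obtain ⟨l', hl'⟩ := this
    exact (hpos l').ne' (h.eq_zero_of_eventually_ne hlim hl')
  by_cases hq : ∀ᶠ k in atTop, ZeroSum.column A (q k) = fun _ => ZeroSum.gameValue A
  · exact h.exists_eventually_ne hne hA2 hcol hn hq
  · refine ⟨l, h.eventually_ne_of_frequently (convex_convexHull ℝ S) (hSfin.isCompact_convexHull ℝ)
      hSne.convexHull hl ?_ (not_eventually.1 hq)⟩
    filter_upwards [h.eventually_mem_of_tendsto hx hlim] with k hk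
    by_cases h0 : q k = 0
    · exact Or.inl (h0 ▸ hcol)
    · exact Or.inr (subset_convexHull ℝ S ⟨q k, ⟨hk, h0⟩, rfl⟩)
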